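/- Let $\mathbb{K}=\mathbb{R}$ or $\mathbb{C}$. For $0<p<\infty$ and a finite sequence $(y_j)_j$ in a normed space $E$ over $\mathbb{K}$ put $w_p((y_j)_j)=\sup\{(\sum_j|\gamma(y_j)|^p)^{1/p}:\gamma\in B_{E'}\}$, where $B_{E'}$ is the closed unit ball of the dual of $E$. For $m\in\mathbb{N}$ and normed spaces $Y$, $X$ over $\mathbb{K}$, let $\Pi_p({}^mY;X)$ be the set of multiple $p$-summing operators, that is, of the continuous $m$-linear maps $T:Y\times\cdots\times Y\to X$ for which there is $C>0$ such that $$\Big(\sum_{j_1,\dots,j_m}\|T(x^1_{j_1},\dots,x^m_{j_m})\|^p\Big)^{1/p}\le C\,w_p((x^1_{j_1})_{j_1})\cdots w_p((x^m_{j_m})_{j_m})$$ for all finite sequences $(x^1_{j_1})_{j_1=1}^{J_1},\dots,(x^m_{j_m})_{j_m=1}^{J_m}$ in $Y$. For $p=\infty$ both $p$-sums are replaced by maxima. For $1\le q\le\infty$, a normed space $X$ is called an $\mathcal{L}^g_q$-space if there is $\lambda\ge1$ such that, for every finite-dimensional subspace $M\subset X$ and every $\varepsilon>0$, there are $n\in\mathbb{N}$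 and continuous linear maps $R:M\to\ell_q^n$ and $S:\ell_q^n\to X$ such that $SR$ is the inclusion $M\hookrightarrow X$ and $\|S\|\,\|R\|\le\lambda+\varepsilon$. **Proposition 1.5.** Let $1\le q\le\infty$ and $0<p<\infty$, let $Y$ be an $\mathcal{L}^g_2$-space and $X$ an $\mathcal{L}^g_q$-space, both over $\mathbb{K}$, and let $m\in\mathbb{N}$. * If $p\ge q$, then $\Pi_p({}^mY;X)=\Pi_q({}^mY;X)$. * If $p\le q$, then $\Pi_p({}^mY;X)\subset\Pi_q({}^mY;X)$. -/

import Mathlib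

open scoped ENNReal

noncomputable section

/-- `weakEllNorm 𝕜 p y` is `w_p(y) = sup {(∑ j, |γ (y j)| ^ p) ^ (1 / p) : γ ∈ B_{E'}}` for a finite
sequence `y` in `E`, where `B_{E'}` is the closed unit ball of the topological dual. The `p`-sum
is Mathlib's `ℓ_p` (quasi-)norm on finite families: `(∑ j, |a j| ^ p) ^ (1 / p)` for `0 < p < ∞`
and `max |a j|` for `p = ∞`. -/
def weakEllNorm (𝕜 : Type*) {E : Type*} [RCLike 𝕜] [NormedAddCommGroup E] [NormedSpace 𝕜 E]
    (p : ℝ≥0∞) {n : ℕ} (y : Fin n → E) : ℝ :=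
  ⨆ γ : Metric.closedBall (0 : StrongDual 𝕜 E) 1,
    ‖(WithLp.toLp p (fun j => γ.1 (y j)) : PiLp p (fun _ : Fin n => 𝕜))‖

/-- A continuous `m`-linear map `T` is multiple `p`-summing if, for some `C > 0`,
`(∑_{j₁, …, jₘ} ‖T (x¹_{j₁}, …, xᵐ_{jₘ})‖ ^ p) ^ (1 / p) ≤ C * w_p(x¹) * ⋯ * w_p(xᵐ)` for all
finite sequences `xⁱ` in `E i`, of arbitrary lengths `J i` (a maximum replaces the `p`-sum for
`p = ∞`). -/
def IsMultipleSumming {𝕜 : Type*} [RCLike 𝕜] {m : ℕ} {E : Fin m → Type*} {F : Type*}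
    [∀ i, NormedAddCommGroup (E i)] [∀ i, NormedSpace 𝕜 (E i)]
    [NormedAddCommGroup F] [NormedSpace 𝕜 F]
    (p : ℝ≥0∞) (T : ContinuousMultilinearMap 𝕜 E F) : Prop :=
  ∃ C : ℝ, 0 < C ∧ ∀ (J : Fin m → ℕ) (x : (i : Fin m) → Fin (J i) → E i),
    ‖(WithLp.toLp p (fun j => T (fun i => x i (j i))) :
        PiLp p (fun _ : ((i : Fin m) → Fin (J i)) => F))‖
      ≤ C * ∏ i, weakEllNorm 𝕜 p (x i)

/-- The class `Π_p(ᵐY; X)` of multiple `p`-summing `m`-linear maps from `Y × ⋯ × Y` to `X`. -/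
def multipleSumming (𝕜 : Type*) [RCLike 𝕜] (p : ℝ≥0∞) (m : ℕ) (Y X : Type*)
    [NormedAddCommGroup Y] [NormedSpace 𝕜 Y] [NormedAddCommGroup X] [NormedSpace 𝕜 X] :
    Set (ContinuousMultilinearMap 𝕜 (fun _ : Fin m => Y) X) :=
  {T | IsMultipleSumming p T}

/-- `X` is an `ℒ^g_{q,lam}`-space: for each finite-dimensional subspace `M` of `X` and each `ε > 0`
the inclusion of `M` into `X` factors as `S ∘ R` through some `ℓ_q^n`, with
`‖S‖ * ‖R‖ ≤ lam + ε`. -/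
def IsLgSpaceWith (𝕜 : Type*) [RCLike 𝕜] (q : ℝ≥0∞) [Fact (1 ≤ q)] (lam : ℝ) (X : Type*)
    [NormedAddCommGroup X] [NormedSpace 𝕜 X] : Prop :=
  ∀ M : Submodule 𝕜 X, FiniteDimensional 𝕜 M → ∀ ε : ℝ, 0 < ε →
    ∃ (n : ℕ) (R : M →L[𝕜] PiLp q (fun _ : Fin n => 𝕜))
      (S : PiLp q (fun _ : Fin n => 𝕜) →L[𝕜] X),
      (∀ x : M, S (R x) = (x : X)) ∧ ‖S‖ * ‖R‖ ≤ lam + ε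

/-- `X` is an `ℒ^g_q`-space: it is an `ℒ^g_{q,lam}`-space for some `lam ≥ 1`. -/
def IsLgSpace (𝕜 : Type*) [RCLike 𝕜] (q : ℝ≥0∞) [Fact (1 ≤ q)] (X : Type*)
    [NormedAddCommGroup X] [NormedSpace 𝕜 X] : Prop :=
  ∃ lam : ℝ, 1 ≤ lam ∧ IsLgSpaceWith 𝕜 q lam X

end

/-! Let `q` be finite. Everything follows from one claim: a multiple `r`-summing map is multiple
`s`-summing whenever `s ≥ q`, whatever `r > 0` is. The pairs `(r, s) = (p, q)` and `(q, p)` give the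
two inclusions. For `q = ∞` the class on the right contains every continuous multilinear map.

The claim compares both summing inequalities with the mean of `‖T‖ ^ r` over sign vectors. Let `u :
ℓ_2^N → ℓ_q^n` be linear with coordinate functionals `u_k`. Minkowski's inequality, for `s ≥ q`,
bounds the strong `s`-sum of `u` along a family by its weak `s`-norm times `(∑ ‖u_k‖ ^ q) ^ (1 /
q)`. By Khinchine, the last factor is at most a constant times the `q`-th moment of `u` at random
signs, and a Kahane-type inequality replaces this moment by the `r`-th one
(`exists_linear_sum_le_signs`). Applying this in one variable at a time, with Minkowski for `r ≤ s`
to exchange the sums, gives the multilinear version (`multilinear_sum_le`).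

Conversely, the upper Khinchine inequality bounds the weak `r`-norm of all sign vectors by a
constant times `2 ^ (N / r)`, so a multiple `r`-summing map has bounded mean there
(`exists_mean_signs_le`). The local structure of `Y` and `X` reduces the general case to `ℓ_2^N` and
`ℓ_q^n`, with constants independent of `N` and `n`. -/

/-! ### Inequalities for finite sums and means -/

/-- Minkowski's inequality for finite sums of nonnegative functions. -/
theorem rpow_sum_sum_le {ι κ : Type*} [Fintype ι] (T : Finset κ) {t : ℝ} (ht : 1 ≤ t)
    (f : ι → κ → ℝ) (hf : ∀ i k, 0 ≤ f i k) :
    (∑ i, (∑ k ∈ T, f i k) ^ t) ^ (1 / t) ≤ ∑ k ∈ T, (∑ i, f i k ^ t) ^ (1 / t) := by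
  classical
  have ht0 : t ≠ 0 := by linarith
  induction T using Finset.induction_on with
  | empty => simp [Real.zero_rpow ht0, Real.zero_rpow (inv_ne_zero ht0)]
  | insert a T ha ih =>
    simp only [Finset.sum_insert ha]
    refine (Real.Lp_add_le_of_nonneg Finset.univ ht (fun i _ => hf i a)
      (fun i _ => Finset.sum_nonneg fun k _ => hf i k)).trans ?_
    gcongr

/-- Interchange of mixed `ℓ_r(ℓ_s)` sums for `r ≤ s`. -/
theorem mixed_sum_le {ι κ : Type*} [Fintype ι] [Fintype κ] {r s : ℝ} (hr : 0 < r) (hrs : r ≤ s)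
    (f : ι → κ → ℝ) (hf : ∀ i k, 0 ≤ f i k) :
    (∑ i, ((∑ k, f i k ^ r) ^ (1 / r)) ^ s) ^ (1 / s) ≤
      (∑ k, ((∑ i, f i k ^ s) ^ (1 / s)) ^ r) ^ (1 / r) := by
  have hs : 0 < s := hr.trans_le hrs
  have ht : 1 ≤ s / r := (one_le_div hr).2 hrs
  -- Apply the triangle inequality of `ℓ_{s/r}` to the functions `f ^ r`.
  have key := rpow_sum_sum_le Finset.univ ht (fun i k => f i k ^ r)
    (fun i k => Real.rpow_nonneg (hf i k) r)
  have h1 : ∀ i, ((∑ k, f i k ^ r) ^ (1 / r)) ^ s = (∑ k, f i k ^ r) ^ (s / r) := fun i => by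
    rw [← Real.rpow_mul (Finset.sum_nonneg fun k _ => Real.rpow_nonneg (hf i k) r)]
    congr 1; ring
  have h2 : ∀ k, ((∑ i, f i k ^ s) ^ (1 / s)) ^ r =
      (∑ i, (f i k ^ r) ^ (s / r)) ^ (1 / (s / r)) := fun k => by
    rw [← Real.rpow_mul (Finset.sum_nonneg fun i _ => Real.rpow_nonneg (hf i k) s)]
    congr 1
    · refine Finset.sum_congr rfl fun i _ => ?_
      rw [← Real.rpow_mul (hf i k)]
      congr 1; field_simp
    · field_simp
  simp only [h1, h2]
  have h0 : 0 ≤ ∑ i, (∑ k, f i k ^ r) ^ (s / r) := Finset.sum_nonneg fun i _ =>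
    Real.rpow_nonneg (Finset.sum_nonneg fun k _ => Real.rpow_nonneg (hf i k) r) _
  calc (∑ i, (∑ k, f i k ^ r) ^ (s / r)) ^ (1 / s)
      = ((∑ i, (∑ k, f i k ^ r) ^ (s / r)) ^ (1 / (s / r))) ^ (1 / r) := by
        rw [← Real.rpow_mul h0]; congr 1; field_simp
    _ ≤ _ := by gcongr

/-- Power means increase with the exponent. -/
theorem powerMean_mono {Ω : Type*} [Fintype Ω] [Nonempty Ω] {f : Ω → ℝ} (hf : ∀ ω, 0 ≤ f ω)
    {r s : ℝ} (hr : 0 < r) (hrs : r ≤ s) :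
    ((Fintype.card Ω : ℝ)⁻¹ * ∑ ω, f ω ^ r) ^ (1 / r) ≤
      ((Fintype.card Ω : ℝ)⁻¹ * ∑ ω, f ω ^ s) ^ (1 / s) := by
  have hs : 0 < s := hr.trans_le hrs
  have hc : (0 : ℝ) < Fintype.card Ω := by exact_mod_cast Fintype.card_pos
  have key := Real.arith_mean_le_rpow_mean Finset.univ (fun _ : Ω => (Fintype.card Ω : ℝ)⁻¹)
    (fun ω => f ω ^ r) (fun _ _ => by positivity)
    (by simp) (fun ω _ => Real.rpow_nonneg (hf ω) r)
    ((one_le_div hr).2 hrs)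
  have h2 : ∀ ω, (f ω ^ r) ^ (s / r) = f ω ^ s := fun ω => by
    rw [← Real.rpow_mul (hf ω)]; congr 1; field_simp
  simp only [h2, ← Finset.mul_sum] at key
  have h0 : 0 ≤ (Fintype.card Ω : ℝ)⁻¹ * ∑ ω, f ω ^ s :=
    mul_nonneg (by positivity) (Finset.sum_nonneg fun i _ => Real.rpow_nonneg (hf i) s)
  have h1 : 0 ≤ (Fintype.card Ω : ℝ)⁻¹ * ∑ ω, f ω ^ r :=
    mul_nonneg (by positivity) (Finset.sum_nonneg fun i _ => Real.rpow_nonneg (hf i) r)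
  calc _ ≤ (((Fintype.card Ω : ℝ)⁻¹ * ∑ ω, f ω ^ s) ^ (1 / (s / r))) ^ (1 / r) := by gcongr
    _ = _ := by rw [← Real.rpow_mul h0]; congr 1; field_simp

/-- If the second moment of a nonnegative function is controlled by its mean, then its mean is
controlled by all its power means. -/
theorem exists_mean_le_powerMean {K : ℝ} (hK : 0 < K) {ρ : ℝ} (hρ : 0 < ρ) :
    ∃ D : ℝ, 0 < D ∧ ∀ (Ω : Type) [Fintype Ω] [Nonempty Ω] (g : Ω → ℝ), (∀ ω, 0 ≤ g ω) →
      (Fintype.card Ω : ℝ)⁻¹ * ∑ ω, g ω ^ (2 : ℝ) ≤ K * ((Fintype.card Ω : ℝ)⁻¹ * ∑ ω, g ω) ^ 2 →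
      (Fintype.card Ω : ℝ)⁻¹ * ∑ ω, g ω ≤
        D * ((Fintype.card Ω : ℝ)⁻¹ * ∑ ω, g ω ^ ρ) ^ (1 / ρ) := by
  rcases le_or_gt 1 ρ with h | h
  · refine ⟨1, one_pos, fun Ω _ _ g hg _ => ?_⟩
    simpa using powerMean_mono hg one_pos h
  refine ⟨(2 * (2 * K) ^ (1 - ρ)) ^ (1 / ρ), by positivity, fun Ω _ _ g hg hsq => ?_⟩
  have hc : (0 : ℝ) < Fintype.card Ω := by exact_mod_cast Fintype.card_pos
  set c := (Fintype.card Ω : ℝ)⁻¹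
  have hc' : 0 < c := inv_pos.2 hc
  set a := c * ∑ ω, g ω with ha
  set P := c * ∑ ω, g ω ^ ρ with hP
  have ha0 : 0 ≤ a := mul_nonneg hc'.le (Finset.sum_nonneg fun i _ => hg i)
  have hP0 : 0 ≤ P := mul_nonneg hc'.le (Finset.sum_nonneg fun i _ => Real.rpow_nonneg (hg i) _)
  rcases ha0.eq_or_lt with h0 | h0
  · rw [← h0]; positivity
  -- Truncation level: where `g ≥ l`, `g ≤ g ^ 2 / l`, and the mean of `g ^ 2 / l` is at most `K * a
  -- ^ 2 / l = a / 2`, which the left side absorbs.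
  set l := 2 * K * a with hl
  have hl0 : 0 < l := by positivity
  have hpt : ∀ ω, g ω ≤ l ^ (1 - ρ) * g ω ^ ρ + g ω ^ (2 : ℝ) / l := fun ω => by
    have e1 : 0 ≤ g ω ^ ρ := Real.rpow_nonneg (hg ω) _
    have e2 : 0 ≤ g ω ^ (2 : ℝ) := Real.rpow_nonneg (hg ω) _
    rcases le_total (g ω) l with hle | hle
    · have : g ω = g ω ^ (1 - ρ) * g ω ^ ρ := by
        rw [← Real.rpow_add_of_nonneg (hg ω) (by linarith) hρ.le]; simp
      have h3 : g ω ^ (1 - ρ) ≤ l ^ (1 - ρ) := Real.rpow_le_rpow (hg ω) hle (by linarith)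
      have h4 := mul_le_mul_of_nonneg_right h3 e1
      have h5 : 0 ≤ g ω ^ (2 : ℝ) / l := by positivity
      linarith
    · have h3 : g ω ≤ g ω ^ (2 : ℝ) / l := by
        rw [le_div_iff₀ hl0, Real.rpow_two, sq]
        exact mul_le_mul_of_nonneg_left hle (hg ω)
      have h5 : 0 ≤ l ^ (1 - ρ) * g ω ^ ρ := by positivity
      linarith
  have hav : a ≤ l ^ (1 - ρ) * P + K * a ^ 2 / l := by
    calc a ≤ c * ∑ ω, (l ^ (1 - ρ) * g ω ^ ρ + g ω ^ (2 : ℝ) / l) := by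
          rw [ha]; gcongr with ω _; exact hpt ω
      _ = l ^ (1 - ρ) * P + (c * ∑ ω, g ω ^ (2 : ℝ)) / l := by
          rw [Finset.sum_add_distrib, ← Finset.mul_sum, ← Finset.sum_div, hP]; ring
      _ ≤ _ := by gcongr
  have h6 : K * a ^ 2 / l = a / 2 := by rw [hl]; field_simp
  have h7 : l ^ (1 - ρ) = (2 * K) ^ (1 - ρ) * a ^ (1 - ρ) :=
    Real.mul_rpow (by positivity) ha0
  have h8 : a = a ^ (1 - ρ) * a ^ ρ := by
    rw [← Real.rpow_add h0]; simp
  have h9 : 0 < a ^ (1 - ρ) := Real.rpow_pos_of_pos h0 _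
  have h10 : a ^ ρ ≤ 2 * (2 * K) ^ (1 - ρ) * P := by
    rw [h6, h7] at hav
    have : a ^ (1 - ρ) * a ^ ρ ≤ a ^ (1 - ρ) * (2 * (2 * K) ^ (1 - ρ) * P) := by
      rw [← h8]; linarith
    exact le_of_mul_le_mul_left this h9
  calc a = (a ^ ρ) ^ (1 / ρ) := by rw [← Real.rpow_mul ha0]; field_simp; simp
    _ ≤ (2 * (2 * K) ^ (1 - ρ) * P) ^ (1 / ρ) := by gcongr
    _ = _ := Real.mul_rpow (by positivity) hP0

/-! ### Random signs and Khinchine's inequalities -/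

/-- The sign `1` or `-1` encoded by a Boolean. -/
def boolSign (R : Type*) [Ring R] (b : Bool) : R := if b then 1 else -1

theorem sum_fin_succ_bool {M : Type*} [AddCommMonoid M] {N : ℕ} (f : (Fin (N + 1) → Bool) → M) :
    ∑ ε, f ε = ∑ ε : Fin N → Bool, (f (Fin.cons true ε) + f (Fin.cons false ε)) := by
  rw [← (Fin.consEquiv fun _ : Fin (N + 1) => Bool).sum_comp, Fintype.sum_prod_type,
    Fintype.sum_bool, ← Finset.sum_add_distrib]
  rfl

/-- Each sign is averaged out by the parallelogram law; the free vector `v` carries the terms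
already treated through the induction. -/
theorem sum_norm_sq_signs {E : Type*} (𝕜 : Type*) [RCLike 𝕜] [NormedAddCommGroup E]
    [InnerProductSpace 𝕜 E] {N : ℕ} (a : Fin N → E) (v : E) :
    ∑ ε : Fin N → Bool, ‖v + ∑ i, boolSign 𝕜 (ε i) • a i‖ ^ 2 =
      2 ^ N * (‖v‖ ^ 2 + ∑ i, ‖a i‖ ^ 2) := by
  induction N generalizing v with
  | zero => simp
  | succ N ih =>
    have h1 : ∀ x : E, v + (a 0 + x) = (v + a 0) + x := fun x => by abel
    have h2 : ∀ x : E, v + (-a 0 + x) = (v - a 0) + x := fun x => by abel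
    have hp := parallelogram_law_with_norm 𝕜 v (a 0)
    simp only [sum_fin_succ_bool, Fin.sum_univ_succ, Fin.cons_zero, Fin.cons_succ,
      Finset.sum_add_distrib]
    simp only [boolSign, if_true, one_smul, neg_smul, h1, h2, Bool.false_eq_true, if_false]
    have e1 := ih (fun i => a i.succ) (v + a 0)
    have e2 := ih (fun i => a i.succ) (v - a 0)
    simp only [boolSign] at e1 e2
    rw [e1, e2, ← mul_add, pow_succ]
    linear_combination 2 ^ N * hp

/-- By independence the sum factors into `2 * cosh (a i)`, and `cosh t ≤ exp (t ^ 2 / 2)`. -/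
theorem sum_exp_signs_le {N : ℕ} (a : Fin N → ℝ) :
    ∑ ε : Fin N → Bool, Real.exp (∑ i, boolSign ℝ (ε i) * a i) ≤
      2 ^ N * Real.exp ((∑ i, a i ^ 2) / 2) := by
  have h := (Finset.prod_univ_sum (fun _ : Fin N => (Finset.univ : Finset Bool))
    (fun i b => Real.exp (boolSign ℝ b * a i))).symm
  rw [Fintype.piFinset_univ] at h
  simp only [Real.exp_sum]
  rw [h, Finset.sum_div, Real.exp_sum]
  calc ∏ i, ∑ b, Real.exp (boolSign ℝ b * a i) ≤ ∏ i, (2 * Real.exp (a i ^ 2 / 2)) := by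
        refine Finset.prod_le_prod (fun i _ => by positivity) fun i _ => ?_
        have := Real.cosh_le_exp_half_sq (a i)
        rw [Real.cosh_eq] at this
        simp only [Fintype.sum_bool, boolSign, if_true, one_mul, neg_mul, Bool.false_eq_true,
          if_false]
        linarith
    _ = _ := by simp [Finset.prod_mul_distrib]

theorem exists_abs_rpow_le_exp (r : ℝ) (hr : 0 < r) :
    ∃ C : ℝ, 0 < C ∧ ∀ x : ℝ, |x| ^ r ≤ C * (Real.exp x + Real.exp (-x)) := by
  refine ⟨1 + (⌈r⌉₊.factorial : ℝ), by positivity, fun x => ?_⟩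
  have h1 : |x| ^ r ≤ 1 + |x| ^ ⌈r⌉₊ := by
    rcases le_total |x| 1 with h | h
    · have := Real.rpow_le_one (abs_nonneg x) h hr.le
      have : 0 ≤ |x| ^ ⌈r⌉₊ := by positivity
      linarith
    · have := Real.rpow_le_rpow_of_exponent_le h (Nat.le_ceil r)
      rw [Real.rpow_natCast] at this
      linarith
  have h2 := Real.pow_div_factorial_le_exp _ (abs_nonneg x) ⌈r⌉₊
  rw [div_le_iff₀ (by positivity)] at h2
  have h3 : Real.exp |x| ≤ Real.exp x + Real.exp (-x) := by
    rcases abs_cases x with ⟨h, _⟩ | ⟨h, _⟩ <;> rw [h]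
    · linarith [Real.exp_pos (-x)]
    · linarith [Real.exp_pos x]
  have h4 : 1 ≤ Real.exp |x| := Real.one_le_exp (abs_nonneg x)
  calc |x| ^ r ≤ (1 + (⌈r⌉₊.factorial : ℝ)) * Real.exp |x| := by linarith
    _ ≤ _ := by gcongr

/-- Exponentials dominate every power, and the exponential moments are bounded independently of `N`
on the unit ball of `ℓ_2`. -/
theorem exists_sum_abs_signs_rpow_le (r : ℝ) (hr : 0 < r) :
    ∃ B : ℝ, 0 < B ∧ ∀ (N : ℕ) (a : Fin N → ℝ), ∑ i, a i ^ 2 ≤ 1 →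
      ∑ ε : Fin N → Bool, |∑ i, boolSign ℝ (ε i) * a i| ^ r ≤ 2 ^ N * B := by
  obtain ⟨C, hC, h⟩ := exists_abs_rpow_le_exp r hr
  refine ⟨C * (2 * Real.exp (1 / 2)), by positivity, fun N a ha => ?_⟩
  have e1 := sum_exp_signs_le a
  have e2 := sum_exp_signs_le (fun i => -a i)
  simp only [mul_neg, Finset.sum_neg_distrib, neg_sq] at e2
  have e3 : Real.exp ((∑ i, a i ^ 2) / 2) ≤ Real.exp (1 / 2) := by gcongr
  calc _ ≤ ∑ ε : Fin N → Bool, C * (Real.exp (∑ i, boolSign ℝ (ε i) * a i) +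
          Real.exp (-∑ i, boolSign ℝ (ε i) * a i)) := Finset.sum_le_sum fun ε _ => h _
    _ = C * (∑ ε : Fin N → Bool, Real.exp (∑ i, boolSign ℝ (ε i) * a i) +
          ∑ ε : Fin N → Bool, Real.exp (-∑ i, boolSign ℝ (ε i) * a i)) := by
        rw [← Finset.mul_sum, Finset.sum_add_distrib]
    _ ≤ C * (2 ^ N * Real.exp (1 / 2) + 2 ^ N * Real.exp (1 / 2)) := by
        have h5 : (2 : ℝ) ^ N * Real.exp ((∑ i, a i ^ 2) / 2) ≤ 2 ^ N * Real.exp (1 / 2) := by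
          gcongr
        gcongr <;> linarith
    _ = _ := by ring

section
variable (𝕜 : Type*) [RCLike 𝕜]

/-- The vector of `ℓ_2^N` with the coordinates `±1` prescribed by `ε`. -/
def signVec {N : ℕ} (ε : Fin N → Bool) : EuclideanSpace 𝕜 (Fin N) :=
  WithLp.toLp 2 fun i => boolSign 𝕜 (ε i)

variable {𝕜}

theorem signVec_apply {N : ℕ} (ε : Fin N → Bool) (φ : StrongDual 𝕜 (EuclideanSpace 𝕜 (Fin N))) :
    φ (signVec 𝕜 ε) = ∑ i, boolSign 𝕜 (ε i) • φ (EuclideanSpace.single i 1) := by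
  have : signVec 𝕜 ε = ∑ i, boolSign 𝕜 (ε i) • EuclideanSpace.single i (1 : 𝕜) := by
    ext j
    simp [signVec, Finset.sum_apply, Pi.single_apply]
  rw [this, map_sum]
  simp

theorem norm_sq_dual_euclidean {N : ℕ} (φ : StrongDual 𝕜 (EuclideanSpace 𝕜 (Fin N))) :
    ∑ i, ‖φ (EuclideanSpace.single i 1)‖ ^ 2 = ‖φ‖ ^ 2 := by
  obtain ⟨a, rfl⟩ := (InnerProductSpace.toDual 𝕜 (EuclideanSpace 𝕜 (Fin N))).surjective φ
  rw [LinearIsometryEquiv.norm_map, EuclideanSpace.norm_sq_eq]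
  simp [InnerProductSpace.toDual_apply_apply, EuclideanSpace.inner_single_right]

/-- The upper Khinchine inequality. -/
theorem exists_khinchine_upper (𝕜 : Type*) [RCLike 𝕜] (r : ℝ) (hr : 0 < r) :
    ∃ B : ℝ, 0 < B ∧ ∀ (N : ℕ) (φ : StrongDual 𝕜 (EuclideanSpace 𝕜 (Fin N))),
      ∑ ε : Fin N → Bool, ‖φ (signVec 𝕜 ε)‖ ^ r ≤ 2 ^ N * B * ‖φ‖ ^ r := by
  obtain ⟨B, hB, h⟩ := exists_sum_abs_signs_rpow_le r hr
  have unit : ∀ (N : ℕ) (φ : StrongDual 𝕜 (EuclideanSpace 𝕜 (Fin N))), ‖φ‖ ≤ 1 →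
      ∑ ε : Fin N → Bool, ‖φ (signVec 𝕜 ε)‖ ^ r ≤ 2 ^ N * (2 ^ r * (B + B)) := by
    intro N φ hφ
    have hsq : ∑ i, ‖φ (EuclideanSpace.single i 1)‖ ^ 2 ≤ 1 := by
      rw [norm_sq_dual_euclidean]; exact pow_le_one₀ (norm_nonneg _) hφ
    have e1 := h N (fun i => RCLike.re (φ (EuclideanSpace.single i 1)))
      (le_trans (Finset.sum_le_sum fun i _ => by
        rw [← sq_abs]; gcongr; exact RCLike.abs_re_le_norm _) hsq)
    have e2 := h N (fun i => RCLike.im (φ (EuclideanSpace.single i 1)))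
      (le_trans (Finset.sum_le_sum fun i _ => by
        rw [← sq_abs]; gcongr; exact RCLike.abs_im_le_norm _) hsq)
    have hre : ∀ ε : Fin N → Bool, RCLike.re (φ (signVec 𝕜 ε)) =
        ∑ i, boolSign ℝ (ε i) * RCLike.re (φ (EuclideanSpace.single i 1)) := fun ε => by
      rw [signVec_apply, map_sum]
      refine Finset.sum_congr rfl fun i _ => ?_
      cases ε i <;> simp [boolSign]
    have him : ∀ ε : Fin N → Bool, RCLike.im (φ (signVec 𝕜 ε)) =
        ∑ i, boolSign ℝ (ε i) * RCLike.im (φ (EuclideanSpace.single i 1)) := fun ε => by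
      rw [signVec_apply, map_sum]
      refine Finset.sum_congr rfl fun i _ => ?_
      cases ε i <;> simp [boolSign]
    have hpt : ∀ z : 𝕜, ‖z‖ ^ r ≤ 2 ^ r * (|RCLike.re z| ^ r + |RCLike.im z| ^ r) := fun z => by
      have hz : ‖z‖ ≤ |RCLike.re z| + |RCLike.im z| := by
        refine abs_le_of_sq_le_sq' ?_ (by positivity) |>.2
        rw [← RCLike.normSq_eq_def', RCLike.normSq_apply]
        nlinarith [abs_mul_abs_self (RCLike.re z), abs_mul_abs_self (RCLike.im z),
          mul_nonneg (abs_nonneg (RCLike.re z)) (abs_nonneg (RCLike.im z))]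
      have p1 : 0 ≤ |RCLike.re z| ^ r := by positivity
      have p2 : 0 ≤ |RCLike.im z| ^ r := by positivity
      rcases le_total |RCLike.re z| |RCLike.im z| with hle | hle
      · calc ‖z‖ ^ r ≤ (2 * |RCLike.im z|) ^ r := by gcongr; linarith
          _ = 2 ^ r * |RCLike.im z| ^ r := Real.mul_rpow (by norm_num) (abs_nonneg _)
          _ ≤ _ := by gcongr; linarith
      · calc ‖z‖ ^ r ≤ (2 * |RCLike.re z|) ^ r := by gcongr; linarith
          _ = 2 ^ r * |RCLike.re z| ^ r := Real.mul_rpow (by norm_num) (abs_nonneg _)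
          _ ≤ _ := by gcongr; linarith
    calc _ ≤ ∑ ε : Fin N → Bool, 2 ^ r * (|RCLike.re (φ (signVec 𝕜 ε))| ^ r +
            |RCLike.im (φ (signVec 𝕜 ε))| ^ r) := Finset.sum_le_sum fun ε _ => hpt _
      _ = 2 ^ r * (∑ ε : Fin N → Bool, |RCLike.re (φ (signVec 𝕜 ε))| ^ r +
            ∑ ε : Fin N → Bool, |RCLike.im (φ (signVec 𝕜 ε))| ^ r) := by
          rw [← Finset.mul_sum, Finset.sum_add_distrib]
      _ ≤ 2 ^ r * (2 ^ N * B + 2 ^ N * B) := by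
          simp only [hre, him]; gcongr
      _ = _ := by ring
  refine ⟨2 ^ r * (B + B), by positivity, fun N φ => ?_⟩
  rcases eq_or_ne φ 0 with rfl | hφ
  · simp [Real.zero_rpow hr.ne']
  have hn : 0 < ‖φ‖ := norm_pos_iff.2 hφ
  have hu := unit N (((‖φ‖⁻¹ : ℝ) : 𝕜) • φ) (by
    rw [norm_smul, RCLike.norm_ofReal, abs_of_pos (inv_pos.2 hn), inv_mul_cancel₀ hn.ne'])
  have hs : ∀ ε : Fin N → Bool, ‖φ (signVec 𝕜 ε)‖ ^ r =
      ‖φ‖ ^ r * ‖(((‖φ‖⁻¹ : ℝ) : 𝕜) • φ) (signVec 𝕜 ε)‖ ^ r := fun ε => by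
    rw [← Real.mul_rpow hn.le (norm_nonneg _), smul_apply, norm_smul,
      RCLike.norm_ofReal, abs_of_pos (inv_pos.2 hn), mul_inv_cancel_left₀ hn.ne']
  simp only [hs]
  rw [← Finset.mul_sum, mul_comm]
  gcongr

/-- The lower Khinchine inequality. -/
theorem exists_khinchine_lower (𝕜 : Type*) [RCLike 𝕜] (r : ℝ) (hr : 0 < r) :
    ∃ A : ℝ, 0 < A ∧ ∀ (N : ℕ) (φ : StrongDual 𝕜 (EuclideanSpace 𝕜 (Fin N))),
      ‖φ‖ ^ r ≤ A * ((2 ^ N)⁻¹ * ∑ ε : Fin N → Bool, ‖φ (signVec 𝕜 ε)‖ ^ r) := by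
  -- The mean comparison is used for `‖φ ε‖ ^ 2`: its mean is exactly `‖φ‖ ^ 2`, and its second
  -- moment is the fourth moment of `φ`.
  obtain ⟨B, hB, hup⟩ := exists_khinchine_upper 𝕜 4 (by norm_num)
  obtain ⟨D, hD, h⟩ := exists_mean_le_powerMean hB (half_pos hr)
  refine ⟨D ^ (r / 2), by positivity, fun N φ => ?_⟩
  have hcard : (Fintype.card (Fin N → Bool) : ℝ) = 2 ^ N := by simp
  have h2 : (2 ^ N : ℝ)⁻¹ * ∑ ε : Fin N → Bool, ‖φ (signVec 𝕜 ε)‖ ^ 2 = ‖φ‖ ^ 2 := by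
    have := sum_norm_sq_signs 𝕜 (fun i => φ (EuclideanSpace.single i 1)) 0
    simp only [zero_add, norm_zero, ← signVec_apply, norm_sq_dual_euclidean] at this
    rw [this]; simp
  have key := h (Fin N → Bool) (fun ε => ‖φ (signVec 𝕜 ε)‖ ^ 2) (fun ε => by positivity)
  have e4 : ∀ ε : Fin N → Bool, (‖φ (signVec 𝕜 ε)‖ ^ 2) ^ (2 : ℝ) =
      ‖φ (signVec 𝕜 ε)‖ ^ (4 : ℝ) := fun ε => by
    rw [← Real.rpow_natCast, ← Real.rpow_mul (norm_nonneg _)]; norm_num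
  have er : ∀ ε : Fin N → Bool, (‖φ (signVec 𝕜 ε)‖ ^ 2) ^ (r / 2) =
      ‖φ (signVec 𝕜 ε)‖ ^ r := fun ε => by
    rw [← Real.rpow_natCast, ← Real.rpow_mul (norm_nonneg _)]; congr 1; push_cast; ring
  simp only [e4, er, hcard, h2] at key
  have h4 : (2 ^ N : ℝ)⁻¹ * ∑ ε : Fin N → Bool, ‖φ (signVec 𝕜 ε)‖ ^ (4 : ℝ) ≤
      B * (‖φ‖ ^ 2) ^ 2 := by
    rw [inv_mul_le_iff₀ (by positivity)]
    calc _ ≤ _ := hup N φ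
      _ = _ := by
        have : ‖φ‖ ^ (4 : ℝ) = (‖φ‖ ^ 2) ^ 2 := by
          rw [← pow_mul, ← Real.rpow_natCast]; norm_num
        rw [this]; ring
  have hS : 0 ≤ (2 ^ N : ℝ)⁻¹ * ∑ ε : Fin N → Bool, ‖φ (signVec 𝕜 ε)‖ ^ r := by positivity
  calc ‖φ‖ ^ r = (‖φ‖ ^ 2) ^ (r / 2) := by
        rw [← Real.rpow_natCast, ← Real.rpow_mul (norm_nonneg _)]; congr 1; push_cast; ring
    _ ≤ (D * ((2 ^ N : ℝ)⁻¹ * ∑ ε : Fin N → Bool, ‖φ (signVec 𝕜 ε)‖ ^ r) ^ (1 / (r / 2)))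
          ^ (r / 2) := by gcongr; exact key h4
    _ = _ := by
        rw [Real.mul_rpow hD.le (by positivity), ← Real.rpow_mul hS,
          one_div_mul_cancel (half_pos hr).ne', Real.rpow_one]

end

/-! ### Linear maps from `ℓ_2^N` into `ℓ_q^n` -/

/-- `W` bounds the weak `ℓ_s` norm of the finite family `x`. -/
def HasWeakSumBound (𝕜 : Type*) {E : Type*} [RCLike 𝕜] [NormedAddCommGroup E] [NormedSpace 𝕜 E]
    {ι : Type*} [Fintype ι] (s : ℝ) (x : ι → E) (W : ℝ) : Prop :=
  0 ≤ W ∧ ∀ γ : StrongDual 𝕜 E, (∑ j, ‖γ (x j)‖ ^ s) ^ (1 / s) ≤ W * ‖γ‖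

theorem rpow_one_div_rpow {a s : ℝ} (ha : 0 ≤ a) (hs : 0 < s) : (a ^ (1 / s)) ^ s = a := by
  rw [← Real.rpow_mul ha, one_div_mul_cancel hs.ne', Real.rpow_one]

theorem rpow_rpow_one_div {a s : ℝ} (ha : 0 ≤ a) (hs : 0 < s) : (a ^ s) ^ (1 / s) = a := by
  rw [← Real.rpow_mul ha, mul_one_div_cancel hs.ne', Real.rpow_one]

theorem rpow_sum_mul {ι : Type*} [Fintype ι] {s : ℝ} (hs : 0 < s) {C : ℝ} (hC : 0 ≤ C)
    {f : ι → ℝ} (hf : ∀ i, 0 ≤ f i) :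
    (∑ i, (C * f i) ^ s) ^ (1 / s) = C * (∑ i, f i ^ s) ^ (1 / s) := by
  simp only [fun i => Real.mul_rpow hC (hf i) (z := s)]
  rw [← Finset.mul_sum, Real.mul_rpow (by positivity)
    (Finset.sum_nonneg fun i _ => Real.rpow_nonneg (hf i) s), rpow_rpow_one_div hC hs]

theorem rpow_sum_mono {ι : Type*} [Fintype ι] {s : ℝ} (hs : 0 < s) {f g : ι → ℝ}
    (hf : ∀ i, 0 ≤ f i) (hfg : ∀ i, f i ≤ g i) :
    (∑ i, f i ^ s) ^ (1 / s) ≤ (∑ i, g i ^ s) ^ (1 / s) :=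
  Real.rpow_le_rpow (Finset.sum_nonneg fun i _ => Real.rpow_nonneg (hf i) s)
    (Finset.sum_le_sum fun i _ => Real.rpow_le_rpow (hf i) (hfg i) hs.le) (by positivity)

section
variable {𝕜 : Type*} [RCLike 𝕜] {q : ℝ≥0∞}

/-- The `k`-th coordinate functional of a linear map from `ℓ_2^N` into `ℓ_q^n`. -/
def coordFunctional {N n : ℕ}
    (u : EuclideanSpace 𝕜 (Fin N) →ₗ[𝕜] PiLp q (fun _ : Fin n => 𝕜)) (k : Fin n) :
    StrongDual 𝕜 (EuclideanSpace 𝕜 (Fin N)) :=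
  LinearMap.toContinuousLinearMap
    { toFun := fun x => u x k
      map_add' := fun x y => by simp
      map_smul' := fun c x => by simp }

/-- Since `q ≤ s`, Minkowski moves the sum over coordinates outside; what remains for each `k` is
the weak `s`-sum tested on the `k`-th coordinate functional. -/
theorem sum_norm_rpow_le_coord (hq : 0 < q.toReal) {s : ℝ} (hs : q.toReal ≤ s) {N n : ℕ}
    (u : EuclideanSpace 𝕜 (Fin N) →ₗ[𝕜] PiLp q (fun _ : Fin n => 𝕜))
    {ι : Type*} [Fintype ι] {x : ι → EuclideanSpace 𝕜 (Fin N)} {W : ℝ}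
    (hW : HasWeakSumBound 𝕜 s x W) :
    (∑ j, ‖u (x j)‖ ^ s) ^ (1 / s) ≤
      W * (∑ k, ‖coordFunctional u k‖ ^ q.toReal) ^ (1 / q.toReal) := by
  simp only [PiLp.norm_eq_sum hq]
  refine (mixed_sum_le hq hs (fun j k => ‖u (x j) k‖) fun _ _ => norm_nonneg _).trans ?_
  rw [← rpow_sum_mul hq hW.1 fun _ => norm_nonneg _]
  exact rpow_sum_mono hq (fun k => by positivity) fun k => hW.2 (coordFunctional u k)

/-- Lower Khinchine in each coordinate, summed over coordinates; the exponent `q` makes the sum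
reassemble into norms of `ℓ_q^n`. -/
theorem exists_coord_le_signs (𝕜 : Type*) [RCLike 𝕜] (q : ℝ≥0∞)
    (hq : 0 < q.toReal) :
    ∃ A : ℝ, 0 < A ∧ ∀ (N n : ℕ)
      (u : EuclideanSpace 𝕜 (Fin N) →ₗ[𝕜] PiLp q (fun _ : Fin n => 𝕜)),
      ∑ k, ‖coordFunctional u k‖ ^ q.toReal ≤
        A * ((2 ^ N)⁻¹ * ∑ ε : Fin N → Bool, ‖u (signVec 𝕜 ε)‖ ^ q.toReal) := by
  obtain ⟨A, hA, h⟩ := exists_khinchine_lower 𝕜 q.toReal hq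
  refine ⟨A, hA, fun N n u => ?_⟩
  calc _ ≤ ∑ k, A * ((2 ^ N)⁻¹ * ∑ ε : Fin N → Bool,
          ‖coordFunctional u k (signVec 𝕜 ε)‖ ^ q.toReal) := Finset.sum_le_sum fun k _ => h N _
    _ = A * ((2 ^ N)⁻¹ * ∑ ε : Fin N → Bool, ∑ k, ‖u (signVec 𝕜 ε) k‖ ^ q.toReal) := by
        rw [← Finset.mul_sum, ← Finset.mul_sum, Finset.sum_comm]; rfl
    _ = _ := by
        simp only [PiLp.norm_eq_sum hq]
        congr 2
        exact Finset.sum_congr rfl fun ε _ => (rpow_one_div_rpow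
          (Finset.sum_nonneg fun k _ => by positivity) hq).symm

theorem exists_hasWeakSumBound_signs (𝕜 : Type*) [RCLike 𝕜] (r : ℝ) (hr : 0 < r) :
    ∃ B : ℝ, 0 < B ∧ ∀ N : ℕ,
      HasWeakSumBound 𝕜 r (fun ε : Fin N → Bool => signVec 𝕜 ε) (((2 : ℝ) ^ N) ^ (1 / r) * B) := by
  obtain ⟨B, hB, h⟩ := exists_khinchine_upper 𝕜 r hr
  refine ⟨B ^ (1 / r), by positivity, fun N => ⟨by positivity, fun φ => ?_⟩⟩
  calc _ ≤ (2 ^ N * B * ‖φ‖ ^ r) ^ (1 / r) :=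
        Real.rpow_le_rpow (by positivity) (h N φ) (by positivity)
    _ = _ := by
        rw [Real.mul_rpow (by positivity) (by positivity), rpow_rpow_one_div (norm_nonneg _) hr,
          Real.mul_rpow (by positivity) hB.le]

/-- The moments of a Rademacher sum with values in `ℓ_q^n` control its mean `q`-th power. -/
theorem exists_kahane (𝕜 : Type*) [RCLike 𝕜] (q : ℝ≥0∞) [Fact (1 ≤ q)]
    (hq : 0 < q.toReal) {r : ℝ} (hr : 0 < r) :
    ∃ D : ℝ, 0 < D ∧ ∀ (N n : ℕ)
      (u : EuclideanSpace 𝕜 (Fin N) →ₗ[𝕜] PiLp q (fun _ : Fin n => 𝕜)),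
      (2 ^ N)⁻¹ * ∑ ε : Fin N → Bool, ‖u (signVec 𝕜 ε)‖ ^ q.toReal ≤
        D * ((2 ^ N)⁻¹ * ∑ ε : Fin N → Bool, ‖u (signVec 𝕜 ε)‖ ^ r) ^ (q.toReal / r) := by
  obtain ⟨A, hA, hlow⟩ := exists_coord_le_signs 𝕜 q hq
  obtain ⟨B, hB, hup⟩ := exists_hasWeakSumBound_signs 𝕜 (2 * q.toReal) (by positivity)
  -- For `g = ‖u ε‖ ^ q` the second moment is the `2q`-th moment of `u`. The coordinate bound with
  -- `s = 2q`, tested on the sign vectors themselves, gives this `K`; the exponent `r / q` turns `g`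
  -- into `‖u ε‖ ^ r`.
  obtain ⟨D, hD, h⟩ := exists_mean_le_powerMean (K := B ^ (2 * q.toReal) * A ^ 2) (by positivity)
    (div_pos hr hq)
  refine ⟨D, hD, fun N n u => ?_⟩
  have hcard : (Fintype.card (Fin N → Bool) : ℝ) = 2 ^ N := by simp
  have key := h (Fin N → Bool) (fun ε => ‖u (signVec 𝕜 ε)‖ ^ q.toReal) (fun ε => by positivity)
  have e1 : ∀ ε : Fin N → Bool, (‖u (signVec 𝕜 ε)‖ ^ q.toReal) ^ (2 : ℝ) =
      ‖u (signVec 𝕜 ε)‖ ^ (2 * q.toReal) := fun ε => by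
    rw [← Real.rpow_mul (norm_nonneg _), mul_comm]
  have e2 : ∀ ε : Fin N → Bool, (‖u (signVec 𝕜 ε)‖ ^ q.toReal) ^ (r / q.toReal) =
      ‖u (signVec 𝕜 ε)‖ ^ r := fun ε => by
    rw [← Real.rpow_mul (norm_nonneg _), mul_div_cancel₀ _ hq.ne']
  simp only [e1, e2, hcard, one_div_div] at key
  refine key ?_
  set a := (2 ^ N : ℝ)⁻¹ * ∑ ε : Fin N → Bool, ‖u (signVec 𝕜 ε)‖ ^ q.toReal
  set σ := ∑ k, ‖coordFunctional u k‖ ^ q.toReal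
  have hσ0 : 0 ≤ σ := by positivity
  have hσ : σ ≤ A * a := hlow N n u
  have hc := sum_norm_rpow_le_coord hq (by linarith) u (hup N)
  have h2q : 0 < 2 * q.toReal := by positivity
  have hS : ∑ ε : Fin N → Bool, ‖u (signVec 𝕜 ε)‖ ^ (2 * q.toReal) ≤
      2 ^ N * B ^ (2 * q.toReal) * σ ^ 2 := by
    calc _ = ((∑ ε : Fin N → Bool, ‖u (signVec 𝕜 ε)‖ ^ (2 * q.toReal)) ^ (1 / (2 * q.toReal)))
          ^ (2 * q.toReal) := (rpow_one_div_rpow (by positivity) h2q).symm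
      _ ≤ _ := Real.rpow_le_rpow (by positivity) hc h2q.le
      _ = _ := by
        rw [Real.mul_rpow (by positivity) (by positivity), Real.mul_rpow (by positivity) hB.le,
          rpow_one_div_rpow (by positivity) h2q, ← Real.rpow_mul hσ0 (1 / q.toReal)]
        have : 1 / q.toReal * (2 * q.toReal) = 2 := by field_simp
        rw [this, Real.rpow_two]
  rw [inv_mul_le_iff₀ (by positivity)]
  calc _ ≤ _ := hS
    _ ≤ 2 ^ N * B ^ (2 * q.toReal) * (A * a) ^ 2 := by gcongr
    _ = _ := by ring

/-- For `s ≥ q` the strong `ℓ_s` norm of the image of a family under a linear map into `ℓ_q^n` is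
controlled by the weak `ℓ_s` norm of the family and the moments of the map at sign vectors. -/
theorem exists_linear_sum_le_signs (𝕜 : Type*) [RCLike 𝕜] (q : ℝ≥0∞) [Fact (1 ≤ q)]
    (hq : 0 < q.toReal) {r s : ℝ} (hr : 0 < r) (hs : q.toReal ≤ s) :
    ∃ K : ℝ, 0 < K ∧ ∀ (N n : ℕ)
      (u : EuclideanSpace 𝕜 (Fin N) →ₗ[𝕜] PiLp q (fun _ : Fin n => 𝕜))
      (ι : Type) [Fintype ι] (x : ι → EuclideanSpace 𝕜 (Fin N)) (W : ℝ),
      HasWeakSumBound 𝕜 s x W →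
      (∑ j, ‖u (x j)‖ ^ s) ^ (1 / s) ≤
        K * W * ((2 ^ N)⁻¹ * ∑ ε : Fin N → Bool, ‖u (signVec 𝕜 ε)‖ ^ r) ^ (1 / r) := by
  obtain ⟨A, hA, hlow⟩ := exists_coord_le_signs 𝕜 q hq
  obtain ⟨D, hD, hkah⟩ := exists_kahane 𝕜 q hq hr
  refine ⟨(A * D) ^ (1 / q.toReal), by positivity, fun N n u ι _ x W hW => ?_⟩
  have hm : 0 ≤ (2 ^ N : ℝ)⁻¹ * ∑ ε : Fin N → Bool, ‖u (signVec 𝕜 ε)‖ ^ r := by positivity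
  set a := (2 ^ N : ℝ)⁻¹ * ∑ ε : Fin N → Bool, ‖u (signVec 𝕜 ε)‖ ^ r
  have h1 : ∑ k, ‖coordFunctional u k‖ ^ q.toReal ≤ A * D * a ^ (q.toReal / r) := by
    refine (hlow N n u).trans ?_
    rw [mul_assoc]
    exact mul_le_mul_of_nonneg_left (hkah N n u) hA.le
  calc _ ≤ _ := sum_norm_rpow_le_coord hq hs u hW
    _ ≤ W * (A * D * a ^ (q.toReal / r)) ^ (1 / q.toReal) := by
        have := hW.1
        gcongr
    _ = _ := by
        rw [Real.mul_rpow (by positivity) (by positivity), ← Real.rpow_mul hm]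
        have : q.toReal / r * (1 / q.toReal) = 1 / r := by field_simp
        rw [this]; ring

end

/-! ### Passage from linear to multilinear maps -/

section
variable {𝕜 : Type*} [RCLike 𝕜] {E Z : Type*} [NormedAddCommGroup E] [NormedSpace 𝕜 E]
  [NormedAddCommGroup Z] [NormedSpace 𝕜 Z]

/-- A summing inequality for linear maps that is tested on a fixed family iterates to multilinear
maps. -/
theorem multilinear_sum_le {r s K : ℝ} (hr : 0 < r) (hrs : r ≤ s) (hK : 0 ≤ K)
    {Ω : Type*} [Fintype Ω] (y : Ω → E)
    (hL : ∀ (u : E →ₗ[𝕜] Z) (ι : Type) [Fintype ι] (x : ι → E) (W : ℝ),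
      HasWeakSumBound 𝕜 s x W →
      (∑ j, ‖u (x j)‖ ^ s) ^ (1 / s) ≤ K * W * (∑ ω, ‖u (y ω)‖ ^ r) ^ (1 / r)) :
    ∀ (m : ℕ) (F : MultilinearMap 𝕜 (fun _ : Fin m => E) Z) (ι : Fin m → Type)
      [∀ i, Fintype (ι i)] (x : (i : Fin m) → ι i → E) (W : Fin m → ℝ),
      (∀ i, HasWeakSumBound 𝕜 s (x i) (W i)) →
      (∑ j : (i : Fin m) → ι i, ‖F fun i => x i (j i)‖ ^ s) ^ (1 / s) ≤
        K ^ m * (∏ i, W i) * (∑ ω : Fin m → Ω, ‖F fun i => y (ω i)‖ ^ r) ^ (1 / r) := by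
  have hs : 0 < s := hr.trans_le hrs
  intro m
  induction m with
  | zero =>
    intro F ι _ x W _
    have h : ∀ v w : Fin 0 → E, F v = F w := fun v w => congrArg F (Subsingleton.elim v w)
    simp only [pow_zero, Finset.univ_eq_empty, Finset.prod_empty, one_mul,
      fun v => h v Fin.elim0, Finset.sum_const, Finset.card_univ, Fintype.card_unique, one_smul]
    rw [rpow_rpow_one_div (norm_nonneg _) hs, rpow_rpow_one_div (norm_nonneg _) hr]
  | succ m ih =>
    intro F ι _ x W hW
    have hcons : ∀ (a : ι 0) (b : (i : Fin m) → ι i.succ),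
        (fun i => x i ((Fin.cons a b : (i : Fin (m + 1)) → ι i) i)) =
          Fin.cons (x 0 a) (fun i => x i.succ (b i)) := fun a b => by
      funext i; refine Fin.cases ?_ (fun i => ?_) i <;> simp
    have hcons' : ∀ (a : Ω) (b : Fin m → Ω),
        (fun i => y ((Fin.cons a b : Fin (m + 1) → Ω) i)) =
          Fin.cons (y a) (fun i => y (b i)) := fun a b => by
      funext i; refine Fin.cases ?_ (fun i => ?_) i <;> simp
    have hsum : ∑ j : (i : Fin (m + 1)) → ι i, ‖F fun i => x i (j i)‖ ^ s =
        ∑ a : ι 0, ((∑ b : (i : Fin m) → ι i.succ,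
          ‖F (Fin.cons (x 0 a) fun i => x i.succ (b i))‖ ^ s) ^ (1 / s)) ^ s := by
      rw [← (Fin.consEquiv ι).sum_comp, Fintype.sum_prod_type]
      refine Finset.sum_congr rfl fun a _ => ?_
      rw [rpow_one_div_rpow (by positivity) hs]
      refine Finset.sum_congr rfl fun b _ => ?_
      rw [← hcons]; rfl
    have hsum' : ∑ ω : Fin (m + 1) → Ω, ‖F fun i => y (ω i)‖ ^ r =
        ∑ b : Fin m → Ω, ((∑ a : Ω,
          ‖F (Fin.cons (y a) fun i => y (b i))‖ ^ r) ^ (1 / r)) ^ r := by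
      rw [← (Fin.consEquiv fun _ => Ω).sum_comp, Fintype.sum_prod_type, Finset.sum_comm]
      refine Finset.sum_congr rfl fun b _ => ?_
      rw [rpow_one_div_rpow (by positivity) hr]
      refine Finset.sum_congr rfl fun a _ => ?_
      rw [← hcons']; rfl
    have hP : 0 ≤ K ^ m * ∏ i : Fin m, W i.succ :=
      mul_nonneg (by positivity) (Finset.prod_nonneg fun i _ => (hW _).1)
    have h0 : 0 ≤ K * W 0 := mul_nonneg hK (hW 0).1
    have hlin : ∀ (b : Fin m → Ω), (∑ a : ι 0, ‖F (Fin.cons (x 0 a) fun i => y (b i))‖ ^ s) ^ (1 / s)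
        ≤ K * W 0 * (∑ a : Ω, ‖F (Fin.cons (y a) fun i => y (b i))‖ ^ r) ^ (1 / r) := fun b => by
      -- Only the first variable is left free; the entry `0` in its slot is overwritten.
      have := hL (F.toLinearMap (Fin.cons 0 fun i => y (b i)) 0) (ι 0) (x 0) (W 0) (hW 0)
      simpa [MultilinearMap.toLinearMap_apply, Fin.update_cons_zero] using this
    rw [hsum, hsum']
    calc _ ≤ (∑ a : ι 0, (K ^ m * (∏ i : Fin m, W i.succ) * (∑ b : Fin m → Ω,
            ‖F (Fin.cons (x 0 a) fun i => y (b i))‖ ^ r) ^ (1 / r)) ^ s) ^ (1 / s) :=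
          rpow_sum_mono hs (fun a => by positivity) fun a =>
            ih (F.curryLeft (x 0 a)) (fun i => ι i.succ) (fun i => x i.succ) (fun i => W i.succ)
              fun i => hW i.succ
      _ = K ^ m * (∏ i : Fin m, W i.succ) * (∑ a : ι 0, ((∑ b : Fin m → Ω,
            ‖F (Fin.cons (x 0 a) fun i => y (b i))‖ ^ r) ^ (1 / r)) ^ s) ^ (1 / s) :=
          rpow_sum_mul hs hP fun a => by positivity
      _ ≤ K ^ m * (∏ i : Fin m, W i.succ) * (∑ b : Fin m → Ω, ((∑ a : ι 0,
            -- The other variables now run over the test family. Putting the `s`-sum over `a` inside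
            -- allows the linear estimate for each fixed `b`.
            ‖F (Fin.cons (x 0 a) fun i => y (b i))‖ ^ s) ^ (1 / s)) ^ r) ^ (1 / r) := by
          refine mul_le_mul_of_nonneg_left ?_ hP
          exact mixed_sum_le hr hrs (fun a (b : Fin m → Ω) =>
            ‖F (Fin.cons (x 0 a) fun i => y (b i))‖) fun _ _ => norm_nonneg _
      _ ≤ K ^ m * (∏ i : Fin m, W i.succ) * (∑ b : Fin m → Ω, (K * W 0 * (∑ a : Ω,
            ‖F (Fin.cons (y a) fun i => y (b i))‖ ^ r) ^ (1 / r)) ^ r) ^ (1 / r) := by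
          refine mul_le_mul_of_nonneg_left ?_ hP
          exact rpow_sum_mono hr (fun b => by positivity) hlin
      _ = _ := by
          rw [rpow_sum_mul hr h0 fun b => by positivity, Fin.prod_univ_succ, pow_succ]
          ring

end

theorem exists_multilinear_sum_le_signs_of_le (𝕜 : Type*) [RCLike 𝕜] (q : ℝ≥0∞) [Fact (1 ≤ q)]
    (hq : 0 < q.toReal) {r s : ℝ} (hr : 0 < r) (hs : q.toReal ≤ s) (hrs : r ≤ s) (m : ℕ) :
    ∃ K : ℝ, 0 < K ∧ ∀ (N n : ℕ)
      (F : MultilinearMap 𝕜 (fun _ : Fin m => EuclideanSpace 𝕜 (Fin N))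
        (PiLp q (fun _ : Fin n => 𝕜)))
      (ι : Fin m → Type) [∀ i, Fintype (ι i)] (x : (i : Fin m) → ι i → EuclideanSpace 𝕜 (Fin N))
      (W : Fin m → ℝ), (∀ i, HasWeakSumBound 𝕜 s (x i) (W i)) →
      (∑ j : (i : Fin m) → ι i, ‖F fun i => x i (j i)‖ ^ s) ^ (1 / s) ≤
        K * (∏ i, W i) * (((2 ^ N) ^ m)⁻¹ *
          ∑ ω : Fin m → Fin N → Bool, ‖F fun i => signVec 𝕜 (ω i)‖ ^ r) ^ (1 / r) := by
  obtain ⟨K, hK, h⟩ := exists_linear_sum_le_signs 𝕜 q hq hr hs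
  refine ⟨K ^ m, by positivity, fun N n F ι _ x W hW => ?_⟩
  -- Scaling the sign vectors by `2 ^ (-N / r)` turns the unnormalised `r`-sum over the test family
  -- into a mean.
  set c : ℝ := ((2 ^ N : ℝ)⁻¹) ^ (1 / r) with hc
  have hc0 : 0 ≤ c := by positivity
  have hcr : c ^ r = (2 ^ N : ℝ)⁻¹ := rpow_one_div_rpow (by positivity) hr
  have hnc : ‖(c : 𝕜)‖ = c := by rw [RCLike.norm_ofReal, abs_of_nonneg hc0]
  have hlin : ∀ (u : EuclideanSpace 𝕜 (Fin N) →ₗ[𝕜] PiLp q (fun _ : Fin n => 𝕜)) (ι : Type)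
      [Fintype ι] (x : ι → EuclideanSpace 𝕜 (Fin N)) (W : ℝ), HasWeakSumBound 𝕜 s x W →
      (∑ j, ‖u (x j)‖ ^ s) ^ (1 / s) ≤
        K * W * (∑ ε : Fin N → Bool, ‖u ((c : 𝕜) • signVec 𝕜 ε)‖ ^ r) ^ (1 / r) := by
    intro u ι _ x W hW
    have e : ∀ ε : Fin N → Bool, ‖u ((c : 𝕜) • signVec 𝕜 ε)‖ ^ r =
        (2 ^ N : ℝ)⁻¹ * ‖u (signVec 𝕜 ε)‖ ^ r := fun ε => by
      rw [map_smul, norm_smul, hnc, Real.mul_rpow hc0 (norm_nonneg _), hcr]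
    simp only [e]
    rw [← Finset.mul_sum]
    exact h N n u ι x W hW
  have key := multilinear_sum_le hr hrs hK.le _ hlin m F ι x W hW
  have e : ∀ ω : Fin m → Fin N → Bool, ‖F fun i => (c : 𝕜) • signVec 𝕜 (ω i)‖ ^ r =
      ((2 ^ N : ℝ) ^ m)⁻¹ * ‖F fun i => signVec 𝕜 (ω i)‖ ^ r := fun ω => by
    rw [F.map_smul_univ (fun _ => (c : 𝕜)), norm_smul, Finset.prod_const, norm_pow, hnc,
      Real.mul_rpow (by positivity) (norm_nonneg _), ← Real.rpow_natCast, ← Real.rpow_mul hc0,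
      mul_comm _ r, Real.rpow_mul hc0, hcr, Real.rpow_natCast, Finset.card_univ, Fintype.card_fin,
      inv_pow]
  simp only [e] at key
  rwa [← Finset.mul_sum] at key

/-- For `s ≥ q` the strong `ℓ_s` norm of the image of families under a multilinear map into `ℓ_q^n`
is controlled by the weak `ℓ_s` norms of the families and the moments of the map at sign vectors. -/
theorem exists_multilinear_sum_le_signs (𝕜 : Type*) [RCLike 𝕜] (q : ℝ≥0∞) [Fact (1 ≤ q)]
    (hq : 0 < q.toReal) {r s : ℝ} (hr : 0 < r) (hs : q.toReal ≤ s) (m : ℕ) :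
    ∃ K : ℝ, 0 < K ∧ ∀ (N n : ℕ)
      (F : MultilinearMap 𝕜 (fun _ : Fin m => EuclideanSpace 𝕜 (Fin N))
        (PiLp q (fun _ : Fin n => 𝕜)))
      (ι : Fin m → Type) [∀ i, Fintype (ι i)] (x : (i : Fin m) → ι i → EuclideanSpace 𝕜 (Fin N))
      (W : Fin m → ℝ), (∀ i, HasWeakSumBound 𝕜 s (x i) (W i)) →
      (∑ j : (i : Fin m) → ι i, ‖F fun i => x i (j i)‖ ^ s) ^ (1 / s) ≤
        K * (∏ i, W i) * (((2 ^ N) ^ m)⁻¹ *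
          ∑ ω : Fin m → Fin N → Bool, ‖F fun i => signVec 𝕜 (ω i)‖ ^ r) ^ (1 / r) := by
  rcases le_total r s with hrs | hsr
  · exact exists_multilinear_sum_le_signs_of_le 𝕜 q hq hr hs hrs m
  have hs0 : 0 < s := hq.trans_le hs
  -- For `r > s` the interchange fails, so take the `s`-th moment and enlarge it to the `r`-th by
  -- monotonicity of power means.
  obtain ⟨K, hK, h⟩ := exists_multilinear_sum_le_signs_of_le 𝕜 q hq hs0 hs le_rfl m
  refine ⟨K, hK, fun N n F ι _ x W hW => (h N n F ι x W hW).trans ?_⟩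
  have hP : 0 ≤ K * ∏ i, W i := mul_nonneg hK.le (Finset.prod_nonneg fun i _ => (hW i).1)
  have hm := powerMean_mono (fun ω : Fin m → Fin N → Bool =>
    norm_nonneg (F fun i => signVec 𝕜 (ω i))) hs0 hsr
  have hcard : (Fintype.card (Fin m → Fin N → Bool) : ℝ) = (2 ^ N) ^ m := by simp
  rw [hcard] at hm
  exact mul_le_mul_of_nonneg_left hm hP

/-! ### Weak norms under maps, reindexing and restriction -/

section
variable {𝕜 : Type*} [RCLike 𝕜] {E E' : Type*} [NormedAddCommGroup E] [NormedSpace 𝕜 E]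
  [NormedAddCommGroup E'] [NormedSpace 𝕜 E']

theorem HasWeakSumBound.map {ι : Type*} [Fintype ι] {s : ℝ} {x : ι → E} {W : ℝ}
    (h : HasWeakSumBound 𝕜 s x W) (S : E →L[𝕜] E') :
    HasWeakSumBound 𝕜 s (fun j => S (x j)) (W * ‖S‖) := by
  refine ⟨mul_nonneg h.1 (norm_nonneg _), fun γ => (h.2 (γ.comp S)).trans ?_⟩
  rw [mul_assoc, mul_comm ‖S‖]
  exact mul_le_mul_of_nonneg_left (γ.opNorm_comp_le S) h.1

theorem HasWeakSumBound.reindex {ι κ : Type*} [Fintype ι] [Fintype κ] {s : ℝ} {x : ι → E} {W : ℝ}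
    (h : HasWeakSumBound 𝕜 s x W) (e : κ ≃ ι) : HasWeakSumBound 𝕜 s (fun j => x (e j)) W := by
  refine ⟨h.1, fun γ => ?_⟩
  rw [e.sum_comp fun j => ‖γ (x j)‖ ^ s]
  exact h.2 γ

/-- By Hahn–Banach, functionals on `M` extend to `E` with the same norm. -/
theorem HasWeakSumBound.codRestrict {ι : Type*} [Fintype ι] {s : ℝ} {x : ι → E} {W : ℝ}
    (h : HasWeakSumBound 𝕜 s x W) (M : Submodule 𝕜 E) (hx : ∀ j, x j ∈ M) :
    HasWeakSumBound 𝕜 s (fun j => (⟨x j, hx j⟩ : M)) W := by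
  refine ⟨h.1, fun γ => ?_⟩
  obtain ⟨g, hg, hn⟩ := exists_extension_norm_eq M γ
  simp only [← hg, ← hn]
  exact h.2 g

theorem weakEllNorm_nonneg (p : ℝ≥0∞) (hp : 0 < p.toReal) {n : ℕ} (x : Fin n → E) :
    0 ≤ weakEllNorm 𝕜 p x :=
  Real.iSup_nonneg fun γ => by
    rw [PiLp.norm_eq_sum hp]; positivity

theorem hasWeakSumBound_weakEllNorm (p : ℝ≥0∞) (hp : 0 < p.toReal) {n : ℕ} (x : Fin n → E) :
    HasWeakSumBound 𝕜 p.toReal x (weakEllNorm 𝕜 p x) := by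
  refine ⟨weakEllNorm_nonneg p hp x, fun γ => ?_⟩
  -- A real supremum over an unbounded set is `0` by default, so boundedness must be checked.
  have hbdd : BddAbove (Set.range fun γ : Metric.closedBall (0 : StrongDual 𝕜 E) 1 =>
      ‖(WithLp.toLp p (fun j => γ.1 (x j)) : PiLp p (fun _ : Fin n => 𝕜))‖) := by
    refine ⟨(∑ j, ‖x j‖ ^ p.toReal) ^ (1 / p.toReal), ?_⟩
    rintro _ ⟨γ, rfl⟩
    simp only [PiLp.norm_eq_sum hp]
    refine rpow_sum_mono hp (fun j => norm_nonneg _) fun j => ?_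
    have hγ : ‖γ.1‖ ≤ 1 := mem_closedBall_zero_iff.1 γ.2
    exact (γ.1.le_of_opNorm_le hγ (x j)).trans_eq (one_mul _)
  rcases eq_or_ne γ 0 with rfl | hγ
  · simp [Real.zero_rpow hp.ne', Real.zero_rpow (inv_ne_zero hp.ne')]
  have hn : 0 < ‖γ‖ := norm_pos_iff.2 hγ
  have hball : ((‖γ‖⁻¹ : ℝ) : 𝕜) • γ ∈ Metric.closedBall (0 : StrongDual 𝕜 E) 1 := by
    rw [mem_closedBall_zero_iff, norm_smul, RCLike.norm_ofReal, abs_of_pos (inv_pos.2 hn),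
      inv_mul_cancel₀ hn.ne']
  have h1 := le_ciSup hbdd ⟨_, hball⟩
  simp only [PiLp.norm_eq_sum hp, smul_apply, norm_smul, RCLike.norm_ofReal,
    abs_of_pos (inv_pos.2 hn)] at h1
  rw [rpow_sum_mul hp (inv_pos.2 hn).le fun j => norm_nonneg _, inv_mul_le_iff₀ hn,
    mul_comm ‖γ‖] at h1
  refine h1.trans (le_of_eq ?_)
  simp only [weakEllNorm, PiLp.norm_eq_sum hp]

theorem weakEllNorm_le (p : ℝ≥0∞) (hp : 0 < p.toReal) {n : ℕ} {x : Fin n → E} {W : ℝ}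
    (h : HasWeakSumBound 𝕜 p.toReal x W) : weakEllNorm 𝕜 p x ≤ W := by
  have : Nonempty (Metric.closedBall (0 : StrongDual 𝕜 E) 1) :=
    ⟨⟨0, Metric.mem_closedBall_self zero_le_one⟩⟩
  refine ciSup_le fun γ => ?_
  rw [PiLp.norm_eq_sum hp]
  have hγ : ‖γ.1‖ ≤ 1 := mem_closedBall_zero_iff.1 γ.2
  exact (h.2 γ.1).trans (mul_le_of_le_one_right h.1 hγ)

end

/-! ### Localization and the theorem -/

section
variable {𝕜 : Type*} [RCLike 𝕜] {Y X : Type*} [NormedAddCommGroup Y] [NormedSpace 𝕜 Y]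
  [NormedAddCommGroup X] [NormedSpace 𝕜 X]

/-- The inequality of a multiple `r`-summing map, tested on the images of sign vectors. -/
theorem exists_mean_signs_le (𝕜 : Type*) [RCLike 𝕜] (r : ℝ≥0∞) (hr : 0 < r.toReal) :
    ∃ B : ℝ, 0 < B ∧ ∀ {Y X : Type*} [NormedAddCommGroup Y] [NormedSpace 𝕜 Y]
      [NormedAddCommGroup X] [NormedSpace 𝕜 X] (m : ℕ)
      (T : ContinuousMultilinearMap 𝕜 (fun _ : Fin m => Y) X) (C : ℝ), 0 ≤ C →
      (∀ (J : Fin m → ℕ) (x : (i : Fin m) → Fin (J i) → Y),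
        ‖(WithLp.toLp r (fun j => T (fun i => x i (j i))) :
          PiLp r (fun _ : ((i : Fin m) → Fin (J i)) => X))‖ ≤ C * ∏ i, weakEllNorm 𝕜 r (x i)) →
      ∀ (N : ℕ) (S : EuclideanSpace 𝕜 (Fin N) →L[𝕜] Y),
        (((2 ^ N) ^ m)⁻¹ * ∑ ω : Fin m → Fin N → Bool,
          ‖T fun i => S (signVec 𝕜 (ω i))‖ ^ r.toReal) ^ (1 / r.toReal) ≤ C * (B * ‖S‖) ^ m := by
  obtain ⟨B, hB, h⟩ := exists_hasWeakSumBound_signs 𝕜 r.toReal hr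
  refine ⟨B, hB, fun {Y X} _ _ _ _ m T C hC hT N S => ?_⟩
  let e : Fin (Fintype.card (Fin N → Bool)) ≃ (Fin N → Bool) := (Fintype.equivFin _).symm
  have hw : weakEllNorm 𝕜 r (fun j => S (signVec 𝕜 (e j))) ≤
      ((2 : ℝ) ^ N) ^ (1 / r.toReal) * B * ‖S‖ :=
    weakEllNorm_le r hr (((h N).map S).reindex e)
  have key := hT (fun _ => Fintype.card (Fin N → Bool)) (fun _ j => S (signVec 𝕜 (e j)))
  rw [PiLp.norm_eq_sum hr, Finset.prod_const, Finset.card_univ, Fintype.card_fin] at key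
  have hsum := (Equiv.piCongrRight fun _ : Fin m => e).sum_comp
    fun ω => ‖T fun i => S (signVec 𝕜 (ω i))‖ ^ r.toReal
  change (∑ j : Fin m → Fin (Fintype.card (Fin N → Bool)),
    ‖T fun i => S (signVec 𝕜 (e (j i)))‖ ^ r.toReal) = _ at hsum
  change (∑ j : Fin m → Fin (Fintype.card (Fin N → Bool)),
    ‖T fun i => S (signVec 𝕜 (e (j i)))‖ ^ r.toReal) ^ (1 / r.toReal) ≤ _ at key
  rw [hsum] at key
  -- The `m` factors `2 ^ (N / r)` from the weak norms cancel the normalisation of the mean over `(2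
  -- ^ N) ^ m` tuples.
  have hpow : (((2 : ℝ) ^ N) ^ m) ^ (1 / r.toReal) = (((2 : ℝ) ^ N) ^ (1 / r.toReal)) ^ m := by
    rw [← Real.rpow_natCast, ← Real.rpow_natCast (_ ^ (1 / r.toReal)),
      ← Real.rpow_mul (by positivity), ← Real.rpow_mul (by positivity), mul_comm]
  rw [Real.mul_rpow (by positivity) (by positivity), Real.inv_rpow (by positivity),
    inv_mul_le_iff₀ (by positivity)]
  calc _ ≤ _ := key
    _ ≤ C * (((2 : ℝ) ^ N) ^ (1 / r.toReal) * B * ‖S‖) ^ m := by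
        gcongr
        exact weakEllNorm_nonneg r hr _
    _ = _ := by rw [hpow, mul_assoc _ B, mul_pow]; ring

/-- Multiple `r`-summing maps from `ℒ^g_2`-spaces into `ℒ^g_q`-spaces are multiple `s`-summing
whenever `s ≥ q`. -/
theorem IsMultipleSumming.of_le_exponent (q : ℝ≥0∞) [Fact (1 ≤ q)] (hq : 0 < q.toReal)
    (hY : IsLgSpace 𝕜 2 Y) (hX : IsLgSpace 𝕜 q X) {r s : ℝ≥0∞} (hr : 0 < r.toReal)
    (hs : q.toReal ≤ s.toReal) {m : ℕ} {T : ContinuousMultilinearMap 𝕜 (fun _ : Fin m => Y) X}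
    (hT : IsMultipleSumming r T) : IsMultipleSumming s T := by
  have hs0 : 0 < s.toReal := hq.trans_le hs
  obtain ⟨lY, hlY, hY⟩ := hY
  obtain ⟨lX, hlX, hX⟩ := hX
  obtain ⟨C, hC, hT⟩ := hT
  obtain ⟨K, hK, hsigns⟩ := exists_multilinear_sum_le_signs 𝕜 q hq hr hs m
  obtain ⟨B, hB, hmean⟩ := exists_mean_signs_le 𝕜 r hr
  -- Both factorizations are taken with `ε = 1`; the one for `Y` enters once per variable.
  refine ⟨(lX + 1) * K * C * B ^ m * (lY + 1) ^ m, by positivity, fun J x => ?_⟩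
  let M : Submodule 𝕜 Y := Submodule.span 𝕜 (⋃ i, Set.range (x i))
  have hxM : ∀ i j, x i j ∈ M := fun i j =>
    Submodule.subset_span (Set.mem_iUnion.2 ⟨i, j, rfl⟩)
  have hM : FiniteDimensional 𝕜 M :=
    FiniteDimensional.span_of_finite 𝕜 (Set.finite_iUnion fun i => Set.finite_range _)
  obtain ⟨N, R, S, hSR, hnSR⟩ := hY M hM 1 one_pos
  -- `M'` must contain the values on the given families, where `S' ∘ R'` is the identity, and those
  -- at the sign vectors, where `‖R'‖` is used.
  let V : Set X := Set.range (fun j : (i : Fin m) → Fin (J i) => T fun i => x i (j i)) ∪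
    Set.range fun ω : Fin m → Fin N → Bool => T fun i => S (signVec 𝕜 (ω i))
  let M' : Submodule 𝕜 X := Submodule.span 𝕜 V
  have hM' : FiniteDimensional 𝕜 M' :=
    FiniteDimensional.span_of_finite 𝕜 ((Set.finite_range _).union (Set.finite_range _))
  obtain ⟨n, R', S', hSR', hnSR'⟩ := hX M' hM' 1 one_pos
  -- A merely algebraic extension suffices: it makes `F` defined everywhere, while norms are only
  -- estimated at values in `M'`, where `g = R'`.
  obtain ⟨g, hg⟩ := LinearMap.exists_extend (R' : M' →ₗ[𝕜] PiLp q (fun _ : Fin n => 𝕜))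
  have hg' : ∀ v : M', g v = R' v := fun v => LinearMap.congr_fun hg v
  let F : MultilinearMap 𝕜 (fun _ : Fin m => EuclideanSpace 𝕜 (Fin N))
      (PiLp q (fun _ : Fin n => 𝕜)) :=
    g.compMultilinearMap (T.toMultilinearMap.compLinearMap fun _ => (S : _ →ₗ[𝕜] Y))
  have hF : ∀ v, F v = g (T fun i => S (v i)) := fun v => rfl
  have hw : ∀ i, 0 ≤ weakEllNorm 𝕜 s (x i) := fun i => weakEllNorm_nonneg s hs0 (x i)
  have hweak : ∀ i, HasWeakSumBound 𝕜 s.toReal (fun j => R ⟨x i j, hxM i j⟩)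
      (weakEllNorm 𝕜 s (x i) * ‖R‖) := fun i =>
    ((hasWeakSumBound_weakEllNorm s hs0 (x i)).codRestrict M (hxM i)).map R
  have h1 := hsigns N n F (fun i => Fin (J i)) (fun i j => R ⟨x i j, hxM i j⟩) _ hweak
  have h2 := hmean m T C hC.le hT N S
  have hleft : ∀ j : (i : Fin m) → Fin (J i), ‖T fun i => x i (j i)‖ ≤
      ‖S'‖ * ‖F fun i => R ⟨x i (j i), hxM i (j i)⟩‖ := fun j => by
    have hmem : (T fun i => x i (j i)) ∈ M' := Submodule.subset_span (Or.inl ⟨j, rfl⟩)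
    rw [hF]
    simp only [hSR]
    rw [hg' ⟨_, hmem⟩]
    have := hSR' ⟨_, hmem⟩
    calc _ = ‖S' (R' ⟨_, hmem⟩)‖ := by rw [this]
      _ ≤ _ := S'.le_opNorm _
  have hright : ∀ ω : Fin m → Fin N → Bool, ‖F fun i => signVec 𝕜 (ω i)‖ ≤
      ‖R'‖ * ‖T fun i => S (signVec 𝕜 (ω i))‖ := fun ω => by
    have hmem : (T fun i => S (signVec 𝕜 (ω i))) ∈ M' := Submodule.subset_span (Or.inr ⟨ω, rfl⟩)
    rw [hF, hg' ⟨_, hmem⟩]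
    exact R'.le_opNorm _
  have h3 : (((2 ^ N) ^ m)⁻¹ * ∑ ω : Fin m → Fin N → Bool,
      ‖F fun i => signVec 𝕜 (ω i)‖ ^ r.toReal) ^ (1 / r.toReal) ≤
        ‖R'‖ * (C * (B * ‖S‖) ^ m) := by
    have h4 := rpow_sum_mono hr (fun ω : Fin m → Fin N → Bool => norm_nonneg _) hright
    rw [rpow_sum_mul hr (norm_nonneg _) fun ω => norm_nonneg _] at h4
    rw [Real.mul_rpow (by positivity) (by positivity)] at h2 ⊢
    calc _ ≤ _ := mul_le_mul_of_nonneg_left h4 (by positivity)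
      _ = _ := mul_left_comm _ _ _
      _ ≤ _ := mul_le_mul_of_nonneg_left h2 (norm_nonneg _)
  have hprod : 0 ≤ ∏ i, weakEllNorm 𝕜 s (x i) := Finset.prod_nonneg fun i _ => hw i
  rw [PiLp.norm_eq_sum hs0]
  calc (∑ j : (i : Fin m) → Fin (J i), ‖T fun i => x i (j i)‖ ^ s.toReal) ^ (1 / s.toReal)
      ≤ (∑ j : (i : Fin m) → Fin (J i),
          (‖S'‖ * ‖F fun i => R ⟨x i (j i), hxM i (j i)⟩‖) ^ s.toReal) ^ (1 / s.toReal) :=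
        rpow_sum_mono hs0 (fun j => norm_nonneg _) hleft
    _ = ‖S'‖ * (∑ j : (i : Fin m) → Fin (J i),
          ‖F fun i => R ⟨x i (j i), hxM i (j i)⟩‖ ^ s.toReal) ^ (1 / s.toReal) :=
        rpow_sum_mul hs0 (norm_nonneg _) fun j => norm_nonneg _
    _ ≤ ‖S'‖ * (K * (∏ i, weakEllNorm 𝕜 s (x i) * ‖R‖) * (‖R'‖ * (C * (B * ‖S‖) ^ m))) := by
        refine mul_le_mul_of_nonneg_left (h1.trans ?_) (norm_nonneg _)
        exact mul_le_mul_of_nonneg_left h3 (mul_nonneg hK.le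
          (Finset.prod_nonneg fun i _ => (hweak i).1))
    _ = (‖S'‖ * ‖R'‖) * K * C * B ^ m * (‖S‖ * ‖R‖) ^ m * ∏ i, weakEllNorm 𝕜 s (x i) := by
        rw [Finset.prod_mul_distrib, Finset.prod_const, Finset.card_univ, Fintype.card_fin]
        ring
    _ ≤ _ := by gcongr

/-- Every continuous multilinear map is multiple `∞`-summing. -/
theorem isMultipleSumming_top {m : ℕ} (T : ContinuousMultilinearMap 𝕜 (fun _ : Fin m => Y) X) :
    IsMultipleSumming ∞ T := by
  -- The summand `1` keeps the constant positive when `T = 0`.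
  refine ⟨‖T‖ + 1, by positivity, fun J x => ?_⟩
  have hw : ∀ i j, ‖x i j‖ ≤ weakEllNorm 𝕜 ∞ (x i) := fun i j => by
    obtain ⟨γ, hγ, hx⟩ := exists_dual_vector'' 𝕜 (x i j)
    have hbdd : BddAbove (Set.range fun γ : Metric.closedBall (0 : StrongDual 𝕜 Y) 1 =>
        ‖(WithLp.toLp ∞ (fun j => γ.1 (x i j)) : PiLp ∞ (fun _ : Fin (J i) => 𝕜))‖) := by
      refine ⟨∑ j, ‖x i j‖, ?_⟩
      rintro _ ⟨γ, rfl⟩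
      simp only [PiLp.norm_eq_ciSup]
      refine Real.iSup_le (fun j => ?_) (by positivity)
      have hγ : ‖γ.1‖ ≤ 1 := mem_closedBall_zero_iff.1 γ.2
      refine ((γ.1.le_of_opNorm_le hγ (x i j)).trans_eq (one_mul _)).trans ?_
      exact Finset.single_le_sum (f := fun j => ‖x i j‖) (fun _ _ => norm_nonneg _)
        (Finset.mem_univ j)
    have h1 := le_ciSup hbdd ⟨γ, by simpa using hγ⟩
    refine le_trans ?_ h1
    have h2 := PiLp.norm_apply_le (WithLp.toLp ∞ (fun j => γ (x i j)) :
      PiLp ∞ (fun _ : Fin (J i) => 𝕜)) j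
    simpa [hx] using h2
  have hw0 : ∀ i, 0 ≤ weakEllNorm 𝕜 ∞ (x i) := fun i =>
    Real.iSup_nonneg fun γ => norm_nonneg _
  rw [PiLp.norm_eq_ciSup]
  refine Real.iSup_le (fun j => ?_)
    (mul_nonneg (by positivity) (Finset.prod_nonneg fun i _ => hw0 i))
  calc _ ≤ ‖T‖ * ∏ i, ‖x i (j i)‖ := T.le_opNorm _
    _ ≤ (‖T‖ + 1) * ∏ i, weakEllNorm 𝕜 ∞ (x i) := by
        gcongr with i _
        · linarith
        · exact hw i (j i)

end

theorem proposition1p5 {𝕜 : Type*} [RCLike 𝕜] {Y X : Type*}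
    [NormedAddCommGroup Y] [NormedSpace 𝕜 Y] [NormedAddCommGroup X] [NormedSpace 𝕜 X]
    (q : ℝ≥0∞) [Fact (1 ≤ q)] (hY : IsLgSpace 𝕜 2 Y) (hX : IsLgSpace 𝕜 q X)
    (p : ℝ≥0∞) (hp0 : 0 < p) (hp : p < ∞) (m : ℕ) :
    (q ≤ p → multipleSumming 𝕜 p m Y X = multipleSumming 𝕜 q m Y X) ∧
    (p ≤ q → multipleSumming 𝕜 p m Y X ⊆ multipleSumming 𝕜 q m Y X) := by
  have hpr : 0 < p.toReal := ENNReal.toReal_pos hp0.ne' hp.ne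
  rcases eq_or_ne q ∞ with rfl | hqt
  · exact ⟨fun h => absurd (hp.trans_le h) (lt_irrefl _), fun _ T _ => isMultipleSumming_top T⟩
  have hq : 0 < q.toReal :=
    ENNReal.toReal_pos (zero_lt_one.trans_le (Fact.out : 1 ≤ q)).ne' hqt
  have hpq : multipleSumming 𝕜 p m Y X ⊆ multipleSumming 𝕜 q m Y X := fun T hT =>
    IsMultipleSumming.of_le_exponent q hq hY hX hpr le_rfl hT
  exact ⟨fun h => hpq.antisymm fun T hT => IsMultipleSumming.of_le_exponent q hq hY hX hq
    (ENNReal.toReal_mono hp.ne h) hT, fun _ => hpq⟩
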